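/- Let $\mathbb{R}^\times$ be the multiplicative group of non-zero reals. Let $(\Sigma,\omega,h)$ be a homogeneous symplectic manifold: $h:(p,z)\mapsto h_z(p)$ is a smooth action of $\mathbb{R}^\times$ on the (finite-dimensional, smooth) manifold $\Sigma$ which makes it a principal $\mathbb{R}^\times$-bundle over a manifold, and $\omega$ is a symplectic form on $\Sigma$ with $h_z^*\omega=z\,\omega$ for all $z\in\mathbb{R}^\times$. Let $I\subseteq\mathbb{R}$ be an interval with non-empty interior and let $(L_s)_{s\in I}$ be a smooth family of homogeneous Lagrangian submanifolds of $\Sigma$: each $L_s$ is an embedded Lagrangian submanifold invariant under all $h_z$, and $L_I=\{(x,s)\in\Sigma\times I : x\in L_s\}$ is an embedded submanifold of $\Sigma\times I$ such that the projection $L_I\to I$ is a surjective submersion. (If $I$ contains an endpoint, this means that near each of its points $L_I$ is the part over $I$ of a submanifold of $\Sigma\times\mathbb{R}$ on which the projection to $\mathbb{R}$ is a submersion at the points of $L_I$.) Let $s_0\in I$ and let $NL_{s_0}=T\Sigma|_{L_{s_0}}/TL_{s_0}$ be the normal bundle. For $x\in L_{s_0}$, an $L$-path through $x$ is a smooth path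 $\gamma$ in $\Sigma$, defined on a neighbourhood of $s_0$ in $I$, with $\gamma(s)\in L_s$ for all $s$ and $\gamma(s_0)=x$. The normal variation of the family at $s_0$ is $\left[\frac{\partial L_s}{\partial s}\right](x):=\left[\gamma'(s_0)\right]\in (NL_{s_0})_x$, for any $L$-path $\gamma$ through $x$, and the variation form $\xi_{s_0}$ on $L_{s_0}$ is defined by $\xi_{s_0}(u)=\omega\left(\left[\frac{\partial L_s}{\partial s}\right](x),u\right)$ for $u\in T_xL_{s_0}$. Then the following hold for every $s_0\in I$. 1. Through every $x\in L_{s_0}$ there is an $L$-path, the class $[\gamma'(s_0)]$ does not depend on the $L$-path $\gamma$ through $x$, and the normal variation and the variation form are a smooth section of $NL_{s_0}$ and a smooth $1$-form on $L_{s_0}$. 2. The normal variation is $0$-homogeneous: $(h_z)_*\left[\frac{\partial L_s}{\partial s}\right]=\left[\frac{\partial L_s}{\partial s}\right]$, that is, $(h_z)_*\left(\left[\frac{\partial L_s}{\partial s}\right](x)\right)=\left[\frac{\partial L_s}{\partial s}\right](h_z(x))$ for all $z\in\mathbb{R}^\times$ and $x\in L_{s_0}$, where $(h_z)_*$ is the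 map $(NL_{s_0})_x\to (NL_{s_0})_{h_z(x)}$ induced by the differential of $h_z$. 3. The variation form is $1$-homogeneous: $h_z^*\xi_{s_0}=z\,\xi_{s_0}$ for all $z\in\mathbb{R}^\times$. 4. Statements 2 and 3 are equivalent: any section $\nu$ of $NL_{s_0}$ (not necessarily smooth) is $0$-homogeneous if and only if the $1$-form $u\mapsto\omega(\nu,u)$ on $L_{s_0}$ is $1$-homogeneous. -/

import Mathlib

open Set
open scoped Manifold ContDiff Topology

noncomputable section

namespace HomLag

/-! ### Submanifolds and their tangent spaces -/

section Submanifold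

variable {E : Type*} [NormedAddCommGroup E] [NormedSpace ℝ E]
  {H : Type*} [TopologicalSpace H] (I : ModelWithCorners ℝ E H)
  {M : Type*} [TopologicalSpace M] [ChartedSpace H M]

/-- `N` is an embedded smooth submanifold of dimension `k` of the manifold `M` (slice charts):
around every point of `N` there is a chart of the maximal smooth atlas of `M` in which `N` is a
linear subspace of dimension `k`. -/
def IsSubmanifold (k : ℕ) (N : Set M) : Prop :=
  ∀ x ∈ N, ∃ φ ∈ IsManifold.maximalAtlas I ∞ M, x ∈ φ.source ∧
    ∃ F : Submodule ℝ E, Module.finrank ℝ F = k ∧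
      ∀ y ∈ φ.source, y ∈ N ↔ φ.extend I y ∈ F

/-- The velocities at time `0` of smooth curves of `M` that lie in `N` and pass through `x` at
time `0`. -/
def curveVelocities (N : Set M) (x : M) : Set (TangentSpace I x) :=
  {v | ∃ c : ℝ → M, ∃ ε > 0, ContMDiffOn 𝓘(ℝ, ℝ) I ∞ c (Ioo (-ε) ε) ∧
    (∀ t ∈ Ioo (-ε) ε, c t ∈ N) ∧ c 0 = x ∧ (v : E) = mfderiv 𝓘(ℝ, ℝ) I c 0 (1 : ℝ)}

/-- The tangent space `T_x N ⊆ T_x M`, for `x` in a submanifold `N` of `M`. (For a submanifold the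
velocities of curves already form a linear subspace.) -/
def tangentSubspace (N : Set M) (x : M) : Submodule ℝ (TangentSpace I x) :=
  Submodule.span ℝ (curveVelocities I N x)

/-- The fibre `T_x M / T_x N` at `x` of the normal bundle of `N`. -/
abbrev NormalSpace (N : Set M) (x : M) : Type _ :=
  TangentSpace I x ⧸ tangentSubspace I N x

variable {I}

/-- The differential of a smooth map that sends `N` to `N'` sends `T_x N` to `T_{f x} N'`. -/
theorem mfderiv_mem_tangentSubspace
    {E' : Type*} [NormedAddCommGroup E'] [NormedSpace ℝ E']
    {H' : Type*} [TopologicalSpace H'] {I' : ModelWithCorners ℝ E' H'}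
    {M' : Type*} [TopologicalSpace M'] [ChartedSpace H' M']
    {f : M → M'} (hf : ContMDiff I I' ∞ f) {N : Set M} {N' : Set M'} (hN : MapsTo f N N')
    (x : M) :
    tangentSubspace I N x ≤ (tangentSubspace I' N' (f x)).comap (mfderiv I I' f x).toLinearMap := by
  refine Submodule.span_le.2 ?_
  rintro v ⟨c, ε, hε, hc, hcN, rfl, hv⟩
  refine Submodule.subset_span ⟨f ∘ c, ε, hε, hf.comp_contMDiffOn hc,
    fun t ht => hN (hcN t ht), rfl, ?_⟩
  have hmem : Ioo (-ε) ε ∈ 𝓝 (0 : ℝ) := Ioo_mem_nhds (by linarith) hε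
  have hc0 : MDifferentiableAt 𝓘(ℝ, ℝ) I c 0 :=
    (hc.contMDiffAt hmem).mdifferentiableAt (by simp)
  rw [mfderiv_comp (I' := I) 0 (hf.mdifferentiable (by simp) (c 0)) hc0]
  have hv' : v = mfderiv 𝓘(ℝ, ℝ) I c 0 (1 : ℝ) := hv
  subst hv'
  rfl

end Submanifold

/-! ### Homogeneous manifolds -/

section Homogeneous

variable {E : Type*} [NormedAddCommGroup E] [NormedSpace ℝ E]
  {M : Type*} [TopologicalSpace M] [ChartedSpace E M]
  {EB : Type*} [NormedAddCommGroup EB] [NormedSpace ℝ EB]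
  {B : Type*} [TopologicalSpace B] [ChartedSpace EB B]

/-- `τ : M → B` is a principal `ℝˣ`-bundle, for a given smooth action of `ℝˣ` on `M`: `τ` is surjective and invariant, and over some neighbourhood `U` of each point of `B` there is an
equivariant diffeomorphism `τ ⁻¹ U → U × ℝˣ` over `U`. -/
structure IsPrincipalBundle [MulAction ℝˣ M] [ContMDiffSMul 𝓘(ℝ, ℝ) 𝓘(ℝ, E) ∞ ℝˣ M]
    (τ : M → B) : Prop where
  surjective : Function.Surjective τ
  invariant : ∀ (z : ℝˣ) (p : M), τ (z • p) = τ p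
  locally_trivial : ∀ b : B, ∃ U : Set B, IsOpen U ∧ b ∈ U ∧
    ∃ ψ : PartialDiffeomorph 𝓘(ℝ, E) (𝓘(ℝ, EB).prod 𝓘(ℝ, ℝ)) M (B × ℝˣ) ∞,
      ψ.source = τ ⁻¹' U ∧ ψ.target = U ×ˢ univ ∧
      ∀ p ∈ ψ.source, (ψ.toPartialEquiv p).1 = τ p ∧
        ∀ z : ℝˣ, ψ.toPartialEquiv (z • p)
          = ((ψ.toPartialEquiv p).1, z * (ψ.toPartialEquiv p).2)

variable (E) in
/-- The differential at `x` of the diffeomorphism `h_z : M → M`, `h_z y = z • y`. -/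
def dAction [MulAction ℝˣ M] (z : ℝˣ) (x : M) :
    TangentSpace 𝓘(ℝ, E) x →L[ℝ] TangentSpace 𝓘(ℝ, E) (z • x) :=
  mfderiv 𝓘(ℝ, E) 𝓘(ℝ, E) (fun y : M => z • y) x

/-- A subset is homogeneous if it is invariant under the action of `ℝˣ`. -/
def IsHomogeneousSet [MulAction ℝˣ M] (N : Set M) : Prop :=
  ∀ (z : ℝˣ), ∀ x ∈ N, z • x ∈ N

end Homogeneous

/-! ### Symplectic forms and Lagrangian submanifolds -/

section Symplectic

variable {E : Type*} [NormedAddCommGroup E] [NormedSpace ℝ E]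
  {M : Type*} [TopologicalSpace M] [ChartedSpace E M]

variable (E M) in
/-- A field of bilinear forms on the tangent spaces of `M`. -/
abbrev BilinField : Type _ :=
  (x : M) → TangentSpace 𝓘(ℝ, E) x →L[ℝ] TangentSpace 𝓘(ℝ, E) x →L[ℝ] ℝ

/-- `Ω` is a symplectic form: a smooth, alternating, nondegenerate and closed 2-form.
Closedness is expressed in the charts `φ` of `M`: the form `η = (φ⁻¹)^* Ω` on the range of `φ`
satisfies `dη = 0`. -/
structure IsSymplectic [IsManifold 𝓘(ℝ, E) ∞ M] (Ω : BilinField E M) : Prop where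
  smooth : ContMDiff 𝓘(ℝ, E) (𝓘(ℝ, E).prod 𝓘(ℝ, E →L[ℝ] E →L[ℝ] ℝ)) ∞
    (fun x => Bundle.TotalSpace.mk' (E →L[ℝ] E →L[ℝ] ℝ) x (Ω x))
  alternating : ∀ (x : M) (v : TangentSpace 𝓘(ℝ, E) x), Ω x v v = 0
  nondegenerate : ∀ (x : M) (v : TangentSpace 𝓘(ℝ, E) x), (∀ w, Ω x v w = 0) → v = 0
  closed : ∀ x₀ : M, ∃ η : E → E [⋀^Fin 2]→L[ℝ] ℝ,
    (∀ y ∈ (extChartAt 𝓘(ℝ, E) x₀).target, ∀ v w : E,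
      η y ![v, w] = Ω ((extChartAt 𝓘(ℝ, E) x₀).symm y)
        (mfderiv 𝓘(ℝ, E) 𝓘(ℝ, E) (extChartAt 𝓘(ℝ, E) x₀).symm y v)
        (mfderiv 𝓘(ℝ, E) 𝓘(ℝ, E) (extChartAt 𝓘(ℝ, E) x₀).symm y w)) ∧
    ∀ y ∈ (extChartAt 𝓘(ℝ, E) x₀).target, extDeriv η y = 0

/-- `h_z^* Ω = z ^ k Ω` for all `z`. -/
def IsHomogeneousBilin [MulAction ℝˣ M] (k : ℤ) (Ω : BilinField E M) : Prop :=
  ∀ (z : ℝˣ) (x : M) (v w : TangentSpace 𝓘(ℝ, E) x),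
    Ω (z • x) (dAction E z x v) (dAction E z x w) = (z : ℝ) ^ k * Ω x v w

/-- `(M, Ω, h)` is a homogeneous symplectic manifold, where `h` is the given action of `ℝˣ` and
`τ` is the projection onto the base of the principal `ℝˣ`-bundle. -/
structure IsHomogeneousSymplectic [IsManifold 𝓘(ℝ, E) ∞ M] [MulAction ℝˣ M]
    [ContMDiffSMul 𝓘(ℝ, ℝ) 𝓘(ℝ, E) ∞ ℝˣ M]
    {EB : Type*} [NormedAddCommGroup EB] [NormedSpace ℝ EB]
    {B : Type*} [TopologicalSpace B] [ChartedSpace EB B]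
    (τ : M → B) (Ω : BilinField E M) : Prop where
  principal : IsPrincipalBundle (E := E) (EB := EB) τ
  symplectic : IsSymplectic Ω
  homogeneous : IsHomogeneousBilin 1 Ω

/-- The form `Ω` vanishes on vectors tangent to `N`. -/
def IsIsotropic (Ω : BilinField E M) (N : Set M) : Prop :=
  ∀ x ∈ N, ∀ u ∈ tangentSubspace 𝓘(ℝ, E) N x, ∀ v ∈ tangentSubspace 𝓘(ℝ, E) N x, Ω x u v = 0

/-- `N` is a Lagrangian submanifold: `dim M = 2 n`, `dim N = n`, and `Ω` vanishes on `N`. -/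
structure IsLagrangian (Ω : BilinField E M) (N : Set M) : Prop where
  isSubmanifold : ∃ n : ℕ, Module.finrank ℝ E = 2 * n ∧ IsSubmanifold 𝓘(ℝ, E) n N
  isotropic : IsIsotropic Ω N

end Symplectic

/-! ### Sections of the normal bundle and 1-forms on a submanifold -/

section Sections

variable {E : Type*} [NormedAddCommGroup E] [NormedSpace ℝ E]
  {M : Type*} [TopologicalSpace M] [ChartedSpace E M]

variable (E) in
/-- A (not necessarily smooth) section of the normal bundle of `N`. -/
abbrev NormalField (N : Set M) : Type _ :=
  (x : N) → NormalSpace 𝓘(ℝ, E) N (x : M)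

variable (E) in
/-- A (not necessarily smooth) 1-form on `N`. -/
abbrev OneForm (N : Set M) : Type _ :=
  (x : N) → tangentSubspace 𝓘(ℝ, E) N (x : M) →ₗ[ℝ] ℝ

/-- A section of the normal bundle of a submanifold is smooth if it is locally the class of a smooth
vector field of the ambient manifold. -/
def NormalField.IsSmooth [IsManifold 𝓘(ℝ, E) ∞ M] {N : Set M} (ν : NormalField E N) : Prop :=
  ∀ x : N, ∃ U : Set M, IsOpen U ∧ (x : M) ∈ U ∧
    ∃ V : (y : M) → TangentSpace 𝓘(ℝ, E) y,
      ContMDiffOn 𝓘(ℝ, E) 𝓘(ℝ, E).tangent ∞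
        (fun y => (⟨y, V y⟩ : TangentBundle 𝓘(ℝ, E) M)) U ∧
      ∀ y : N, (y : M) ∈ U → ν y = Submodule.Quotient.mk (V y)

/-- A 1-form on a submanifold is smooth if it is locally the restriction of a smooth 1-form of the
ambient manifold. -/
def OneForm.IsSmooth [IsManifold 𝓘(ℝ, E) ∞ M] {N : Set M} (ξ : OneForm E N) : Prop :=
  ∀ x : N, ∃ U : Set M, IsOpen U ∧ (x : M) ∈ U ∧
    ∃ α : (y : M) → TangentSpace 𝓘(ℝ, E) y →L[ℝ] ℝ,
      ContMDiffOn 𝓘(ℝ, E) (𝓘(ℝ, E).prod 𝓘(ℝ, E →L[ℝ] ℝ)) ∞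
        (fun y => Bundle.TotalSpace.mk' (E →L[ℝ] ℝ) y (α y)) U ∧
      ∀ y : N, (y : M) ∈ U → ∀ u : tangentSubspace 𝓘(ℝ, E) N (y : M), ξ y u = α y u

/-- The 1-form `u ↦ Ω(ν, u)` on an isotropic `N` that corresponds to a section `ν` of the normal
bundle. -/
def NormalField.toOneForm {N : Set M} (ν : NormalField E N) (Ω : BilinField E M)
    (hN : IsIsotropic Ω N) : OneForm E N :=
  fun x => (tangentSubspace 𝓘(ℝ, E) N (x : M)).liftQ
    ((LinearMap.lcomp ℝ ℝ (tangentSubspace 𝓘(ℝ, E) N (x : M)).subtype).comp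
      ((ContinuousLinearMap.coeLM ℝ).comp (Ω x).toLinearMap))
    (fun v hv => LinearMap.ext fun u => hN x x.2 v hv u u.2) (ν x)

/-- `toOneForm` does what its description says. -/
theorem NormalField.toOneForm_apply {N : Set M} (ν : NormalField E N) (Ω : BilinField E M)
    (hN : IsIsotropic Ω N) (x : N) (v : TangentSpace 𝓘(ℝ, E) (x : M))
    (hv : ν x = Submodule.Quotient.mk v) (u : tangentSubspace 𝓘(ℝ, E) N (x : M)) :
    ν.toOneForm Ω hN x u = Ω x v u := by
  unfold NormalField.toOneForm
  rw [hv]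
  rfl

variable [MulAction ℝˣ M]

/-- The restriction of the action of `ℝˣ` to a homogeneous subset. -/
def IsHomogeneousSet.act {N : Set M} (hN : IsHomogeneousSet N) (z : ℝˣ) (x : N) : N :=
  ⟨z • (x : M), hN z x x.2⟩

theorem dAction_tangent [ContMDiffSMul 𝓘(ℝ, ℝ) 𝓘(ℝ, E) ∞ ℝˣ M] {N : Set M}
    (hN : IsHomogeneousSet N) (z : ℝˣ) (x : M) :
    tangentSubspace 𝓘(ℝ, E) N x
      ≤ (tangentSubspace 𝓘(ℝ, E) N (z • x)).comap (dAction E z x).toLinearMap := by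
  have hf : ContMDiff 𝓘(ℝ, E) 𝓘(ℝ, E) ∞ (fun y : M => z • y) :=
    (ContMDiffSMul.contMDiff_smul (I := 𝓘(ℝ, ℝ)) (I' := 𝓘(ℝ, E)) (n := ∞) (G := ℝˣ) (M := M)).comp
      (contMDiff_const.prodMk contMDiff_id)
  exact mfderiv_mem_tangentSubspace hf (fun y hy => hN z y hy) x

/-- The differential `T_x N → T_{zx} N` of the restriction of `h_z` to `N`. -/
def dActionTangent [ContMDiffSMul 𝓘(ℝ, ℝ) 𝓘(ℝ, E) ∞ ℝˣ M] {N : Set M}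
    (hN : IsHomogeneousSet N) (z : ℝˣ) (x : N) :
    tangentSubspace 𝓘(ℝ, E) N (x : M) →ₗ[ℝ] tangentSubspace 𝓘(ℝ, E) N (hN.act z x : M) :=
  (dAction E z (x : M)).toLinearMap.restrict (dAction_tangent hN z x)

/-- The map `T_x M / T_x N → T_{zx} M / T_{zx} N` induced by the differential of `h_z`. -/
def dActionNormal [ContMDiffSMul 𝓘(ℝ, ℝ) 𝓘(ℝ, E) ∞ ℝˣ M] {N : Set M}
    (hN : IsHomogeneousSet N) (z : ℝˣ) (x : N) :
    NormalSpace 𝓘(ℝ, E) N (x : M) →ₗ[ℝ] NormalSpace 𝓘(ℝ, E) N (hN.act z x : M) :=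
  Submodule.mapQ _ _ (dAction E z (x : M)).toLinearMap (dAction_tangent hN z x)

/-- A section `ν` of the normal bundle is `k`-homogeneous: `(h_z)_* ν = z ^ k ν` for all `z`. -/
def NormalField.IsHomogeneous [ContMDiffSMul 𝓘(ℝ, ℝ) 𝓘(ℝ, E) ∞ ℝˣ M] {N : Set M}
    (ν : NormalField E N) (hN : IsHomogeneousSet N) (k : ℤ) : Prop :=
  ∀ (z : ℝˣ) (x : N), dActionNormal hN z x (ν x) = (z : ℝ) ^ k • ν (hN.act z x)

/-- A 1-form `ξ` on `N` is `k`-homogeneous: `h_z^* ξ = z ^ k ξ` for all `z`. -/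
def OneForm.IsHomogeneous [ContMDiffSMul 𝓘(ℝ, ℝ) 𝓘(ℝ, E) ∞ ℝˣ M] {N : Set M}
    (ξ : OneForm E N) (hN : IsHomogeneousSet N) (k : ℤ) : Prop :=
  ∀ (z : ℝˣ) (x : N) (u : tangentSubspace 𝓘(ℝ, E) N (x : M)),
    ξ (hN.act z x) (dActionTangent hN z x u) = (z : ℝ) ^ k * ξ x u

end Sections

/-! ### Smooth families and their variations -/

section Families

variable {E : Type*} [NormedAddCommGroup E] [NormedSpace ℝ E]
  {M : Type*} [TopologicalSpace M] [ChartedSpace E M]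

/-- The set `L_J = {(x, s) | s ∈ J, x ∈ L_s}`. -/
def totalSet (J : Set ℝ) (L : ℝ → Set M) : Set (M × ℝ) :=
  {p | p.2 ∈ J ∧ p.1 ∈ L p.2}

variable (E) in
/-- `L_J` is a submanifold of `M × J` on which the projection to `J` is a submersion. If the
interval `J` is open, this says that `L_J` is locally a submanifold of `M × ℝ`. An interval with
endpoints is a manifold with boundary, and then `L_J` is locally the part over `J` of a submanifold
of `M × ℝ`. -/
def IsSubmersiveSubmanifold (J : Set ℝ) (L : ℝ → Set M) : Prop :=
  ∀ p ∈ totalSet J L, ∃ W : Set (M × ℝ), IsOpen W ∧ p ∈ W ∧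
    ∃ (k : ℕ) (N : Set (M × ℝ)), IsSubmanifold (𝓘(ℝ, E).prod 𝓘(ℝ, ℝ)) k N ∧
      totalSet J L ∩ W = N ∩ (univ ×ˢ J) ∩ W ∧
      ∀ q ∈ totalSet J L ∩ W, Function.Surjective
        (fun w : tangentSubspace (𝓘(ℝ, E).prod 𝓘(ℝ, ℝ)) N q =>
          mfderiv (𝓘(ℝ, E).prod 𝓘(ℝ, ℝ)) 𝓘(ℝ, ℝ) (Prod.snd : M × ℝ → ℝ) q w)

/-- `(L_s)`, `s ∈ J`, is a smooth family of homogeneous Lagrangian submanifolds. (The last field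
says that the projection `L_J → J` is surjective.) -/
structure IsSmoothFamily [MulAction ℝˣ M] (Ω : BilinField E M) (J : Set ℝ) (L : ℝ → Set M) :
    Prop where
  homogeneous : ∀ s ∈ J, IsHomogeneousSet (L s)
  lagrangian : ∀ s ∈ J, IsLagrangian Ω (L s)
  submersive : IsSubmersiveSubmanifold E J L
  surjective : ∀ s ∈ J, (L s).Nonempty

variable (E) in
/-- The velocities at `s = s₀` of `L`-paths through `x`: smooth paths `γ`, defined on a
neighbourhood of `s₀` in `J`, with `γ s ∈ L_s` and `γ s₀ = x`. -/
def pathVelocities (J : Set ℝ) (L : ℝ → Set M) (s₀ : ℝ) (x : M) :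
    Set (TangentSpace 𝓘(ℝ, E) x) :=
  {v | ∃ γ : ℝ → M, ∃ ε > 0, ContMDiffOn 𝓘(ℝ, ℝ) 𝓘(ℝ, E) ∞ γ (J ∩ Ioo (s₀ - ε) (s₀ + ε)) ∧
    (∀ s ∈ J ∩ Ioo (s₀ - ε) (s₀ + ε), γ s ∈ L s) ∧ γ s₀ = x ∧
    (v : E) = mfderivWithin 𝓘(ℝ, ℝ) 𝓘(ℝ, E) γ J s₀ (1 : ℝ)}

variable (E) in
open Classical in
/-- The normal variation `[∂L_s/∂s]` at `s₀`: its value at `x` is the class in `T_x M / T_x L_{s₀}`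
of the velocity of an `L`-path through `x`. -/
def normalVariation (J : Set ℝ) (L : ℝ → Set M) (s₀ : ℝ) : NormalField E (L s₀) :=
  fun x => if h : (pathVelocities E J L s₀ (x : M)).Nonempty
    then Submodule.Quotient.mk h.some else 0

/-- The variation form `ξ_{s₀}`, `ξ_{s₀}(u) = Ω([∂L_s/∂s], u)`. -/
def variationForm (Ω : BilinField E M) (J : Set ℝ) (L : ℝ → Set M) (s₀ : ℝ)
    (h : IsIsotropic Ω (L s₀)) : OneForm E (L s₀) :=
  (normalVariation E J L s₀).toOneForm Ω h

end Families

end HomLag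

end

/-! Near (x, s₀) a slice chart of M × ℝ turns the total space into a linear subspace F, and
submersivity supplies w ∈ F with nonzero ℝ-component. An `L`-path is, up to the shift s ↦ s - s₀,
the M-part of a curve in the slice whose ℝ-component moves at speed 1. A straight line in F has a
prescribed velocity u, but its ℝ-component need not be affine; `exists_affine_level_curve` repairs
this by a correction a(t) w with a(0) = a'(0) = 0, which leaves the velocity unchanged.

This one construction is used twice. With u the multiple of w of ℝ-component 1 it gives `L`-paths,
whose velocities form a smooth local vector field (existence and smoothness). With u of ℝ-component
0 it gives curves inside L_{s₀}; since the difference of two `L`-path velocities lifts to such a u,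
it is tangent to L_{s₀} (independence of the path).

The action sends `L`-paths to `L`-paths, whence 0-homogeneity. For a section ν, the homogeneity of Ω
shows that the 1-form is 1-homogeneous exactly when (h_z)_* ν - ν is Ω-orthogonal to the image of T
L_{s₀} under dh_z. That image is the whole tangent space, and a Lagrangian subspace is its own
orthogonal, so this says that the difference vanishes in the normal bundle
(`NormalField.isHomogeneous_zero_iff`). The 1-homogeneity of the variation form is then a special
case. -/

noncomputable section

namespace HomLag

/-! ### Curves with prescribed velocity along which a function is affine. -/

section Calculus

variable {Z : Type*} [NormedAddCommGroup Z] [NormedSpace ℝ Z]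

/-- The linear automorphism `(t, a) ↦ (t, b t + c a)` of the plane. -/
def shearEquiv (b c : ℝ) (hc : c ≠ 0) : (ℝ × ℝ) ≃L[ℝ] (ℝ × ℝ) :=
  ContinuousLinearEquiv.equivOfInverse
    ((ContinuousLinearMap.fst ℝ ℝ ℝ).prod
      (b • ContinuousLinearMap.fst ℝ ℝ ℝ + c • ContinuousLinearMap.snd ℝ ℝ ℝ))
    ((ContinuousLinearMap.fst ℝ ℝ ℝ).prod
      (c⁻¹ • (ContinuousLinearMap.snd ℝ ℝ ℝ - b • ContinuousLinearMap.fst ℝ ℝ ℝ)))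
    (fun p => by ext <;> simp [hc])
    (fun p => by ext <;> simp [hc])

theorem shearEquiv_coe (b c : ℝ) (hc : c ≠ 0) :
    (shearEquiv b c hc : (ℝ × ℝ) →L[ℝ] (ℝ × ℝ)) = (ContinuousLinearMap.fst ℝ ℝ ℝ).prod
      (b • ContinuousLinearMap.fst ℝ ℝ ℝ + c • ContinuousLinearMap.snd ℝ ℝ ℝ) := rfl

theorem shearEquiv_symm_apply (b c : ℝ) (hc : c ≠ 0) (p : ℝ × ℝ) :
    (shearEquiv b c hc).symm p = (p.1, c⁻¹ * (p.2 - b * p.1)) := rfl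

/-- Inside the plane through `z` spanned by `u` and `w`, where the derivative of `f` along `w` does
not vanish, there is a curve with velocity `u` at `z` along which `f` is affine. -/
theorem exists_affine_level_curve {f : Z → ℝ} {O : Set Z} (hO : IsOpen O)
    (hf : ContDiffOn ℝ ∞ f O) {z : Z} (hz : z ∈ O) (u w : Z) (hw : fderiv ℝ f z w ≠ 0) :
    ∃ ε > 0, ∃ a : ℝ → ℝ, ContDiffOn ℝ ∞ a (Ioo (-ε) ε) ∧ a 0 = 0 ∧ HasDerivAt a 0 0 ∧
      ∀ t ∈ Ioo (-ε) ε, z + t • u + a t • w ∈ O ∧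
        f (z + t • u + a t • w) = f z + t * fderiv ℝ f z u := by
  set T : ℝ × ℝ → Z := fun p => z + p.1 • u + p.2 • w with hT
  have hT0 : T (0, 0) = z := by simp [hT]
  have hTs : ContDiff ℝ ∞ T := by fun_prop
  set T' : ℝ × ℝ →L[ℝ] Z := (ContinuousLinearMap.fst ℝ ℝ ℝ).smulRight u
    + (ContinuousLinearMap.snd ℝ ℝ ℝ).smulRight w with hT'
  have hTd : ∀ p, HasFDerivAt T T' p := fun p => by
    have h := ((ContinuousLinearMap.hasFDerivAt T' (x := p))).const_add z
    refine h.congr_of_eventuallyEq (Filter.Eventually.of_forall fun q => ?_)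
    simp [hT, hT', add_assoc]
  -- On all of `D` the derivative of `G` below is an invertible shear. This is needed at every
  -- point, not only at the origin, for the local inverse to be smooth along a whole interval.
  set D : Set (ℝ × ℝ) := T ⁻¹' (O ∩ (fun y => fderiv ℝ f y w) ⁻¹' {0}ᶜ) with hD
  have hcont : ContinuousOn (fun y => fderiv ℝ f y w) O :=
    (hf.continuousOn_fderiv_of_isOpen hO (by simp)).clm_apply continuousOn_const
  have hDo : IsOpen D :=
    (hcont.isOpen_inter_preimage hO isOpen_compl_singleton).preimage hTs.continuous
  set G : ℝ × ℝ → ℝ × ℝ := fun p => (p.1, f (T p)) with hG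
  have hfT : ∀ p ∈ D, ContDiffAt ℝ ∞ f (T p) := fun p hp => hf.contDiffAt (hO.mem_nhds hp.1)
  have hGs : ∀ p ∈ D, ContDiffAt ℝ ∞ G p := fun p hp =>
    contDiffAt_fst.prodMk ((hfT p hp).comp p hTs.contDiffAt)
  have hDw : ∀ p ∈ D, fderiv ℝ f (T p) w ≠ 0 := fun p hp => hp.2
  have hGd : ∀ p (hp : p ∈ D), HasFDerivAt G
      (shearEquiv (fderiv ℝ f (T p) u) (fderiv ℝ f (T p) w) (hDw p hp) : (ℝ × ℝ) →L[ℝ] (ℝ × ℝ)) p := by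
    intro p hp
    have h := (hasFDerivAt_fst (𝕜 := ℝ) (p := p)).prodMk
      ((((hfT p hp).differentiableAt (by simp)).hasFDerivAt).comp p (hTd p))
    have h' : (shearEquiv (fderiv ℝ f (T p) u) (fderiv ℝ f (T p) w) (hDw p hp) :
        (ℝ × ℝ) →L[ℝ] (ℝ × ℝ))
        = (ContinuousLinearMap.fst ℝ ℝ ℝ).prod ((fderiv ℝ f (T p)).comp T') := by
      rw [shearEquiv_coe]
      ext <;> simp [hT']
    rw [h']
    exact h
  have h0 : ((0 : ℝ), (0 : ℝ)) ∈ D := by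
    rw [hD, mem_preimage, hT0]
    exact ⟨hz, hw⟩
  set Φ := ((hGs _ h0).toOpenPartialHomeomorph G (hGd _ h0) (by simp)).restrOpen D hDo with hΦ
  have hΦG : ∀ p, Φ p = G p := fun p => rfl
  have hΦs : ∀ p ∈ Φ.source, p ∈ D := fun p hp => hp.2
  have h0Φ : ((0 : ℝ), (0 : ℝ)) ∈ Φ.source :=
    ⟨(hGs _ h0).mem_toOpenPartialHomeomorph_source (hGd _ h0) (by simp), h0⟩
  set l := fderiv ℝ f z u with hl
  -- `G` records the pair (t, value of f), so pulling this line back by the inverse of `G` yields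
  -- the points (t, a(t)) at which f has the required affine values.
  set q : ℝ → ℝ × ℝ := fun t => (t, f z + t * l) with hq
  have hqs : ContDiff ℝ ∞ q := by fun_prop
  have hq0 : q 0 = Φ (0, 0) := by simp [hq, hΦG, hG, hT0]
  have hopen : IsOpen (q ⁻¹' Φ.target) := Φ.open_target.preimage hqs.continuous
  have hmem : (0 : ℝ) ∈ q ⁻¹' Φ.target := by
    rw [mem_preimage, hq0]
    exact Φ.map_source h0Φ
  obtain ⟨ε, hε, hball⟩ := Metric.isOpen_iff.1 hopen 0 hmem
  rw [Real.ball_eq_Ioo, zero_sub, zero_add] at hball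
  have hinv : ∀ t ∈ Ioo (-ε) ε, Φ.symm (q t) ∈ D ∧ G (Φ.symm (q t)) = q t := fun t ht =>
    ⟨hΦs _ (Φ.map_target (hball ht)), Φ.right_inv (hball ht)⟩
  have hs0 : Φ.symm (q 0) = (0, 0) := by rw [hq0]; exact Φ.left_inv h0Φ
  refine ⟨ε, hε, fun t => (Φ.symm (q t)).2, fun t ht => ?_, congrArg Prod.snd hs0, ?_, fun t ht => ?_⟩
  · have h := Φ.contDiffAt_symm (n := ∞) (hball ht) (hGd _ (hinv t ht).1) (hGs _ (hinv t ht).1)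
    exact (contDiffAt_snd.comp t (h.comp t hqs.contDiffAt)).contDiffWithinAt
  · have hd0 : HasFDerivAt Φ
        (shearEquiv l (fderiv ℝ f z w) hw : (ℝ × ℝ) →L[ℝ] (ℝ × ℝ)) (Φ.symm (q 0)) := by
      rw [hs0]
      have := hGd _ h0
      rw [shearEquiv_coe] at this ⊢
      rwa [hT0] at this
    have hqd : HasDerivAt q (1, l) 0 := by
      have h1 : HasDerivAt (fun t : ℝ => f z + t * l) (1 * l) 0 :=
        ((hasDerivAt_id (0 : ℝ)).mul_const l).const_add _
      rw [one_mul] at h1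
      exact (hasDerivAt_id (0 : ℝ)).prodMk h1
    have h := (hasFDerivAt_snd.comp (q 0)
      (Φ.hasFDerivAt_symm (hball (by simp [hε])) hd0)).comp_hasDerivAt (0 : ℝ) hqd
    -- The direction u alone already changes f at rate l, so no correction along w is needed to
    -- first order: a'(0) = 0.
    have h' : (shearEquiv l (fderiv ℝ f z w) hw).symm (1, l) = (1, 0) := by
      simp [shearEquiv_symm_apply]
    have h'' : ((ContinuousLinearMap.snd ℝ ℝ ℝ).comp
        ((shearEquiv l (fderiv ℝ f z w) hw).symm : (ℝ × ℝ) →L[ℝ] (ℝ × ℝ))) (1, l) = 0 :=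
      congrArg Prod.snd h'
    rw [h''] at h
    exact h
  · obtain ⟨h1, h2⟩ := hinv t ht
    have e1 : (Φ.symm (q t)).1 = t := congrArg Prod.fst h2
    have e2 : f (T (Φ.symm (q t))) = f z + t * l := congrArg Prod.snd h2
    have e3 : T (Φ.symm (q t)) = z + t • u + (Φ.symm (q t)).2 • w := by simp only [hT, e1]
    rw [← e3]
    exact ⟨h1.1, e2⟩

/-- The derivative of a curve that stays in a finite-dimensional subspace lies in this subspace. -/
theorem derivWithin_mem_of_eventually_mem {F : Submodule ℝ Z} [FiniteDimensional ℝ F]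
    {c : ℝ → Z} {c' : Z} {J : Set ℝ} {t₀ : ℝ} (hJ : UniqueDiffWithinAt ℝ J t₀)
    (hc : HasDerivWithinAt c c' J t₀) (h₀ : c t₀ ∈ F) (hF : ∀ᶠ t in 𝓝[J] t₀, c t ∈ F) :
    c' ∈ F := by
  have h := hasDerivWithinAt_iff_tendsto_slope.1 hc
  have hne : (𝓝[J \ {t₀}] t₀).NeBot :=
    accPt_principal_iff_nhdsWithin.1 hJ.accPt
  -- Difference quotients of points of `F` lie in `F`, and `F` is closed.
  refine F.closed_of_finiteDimensional.mem_of_tendsto h ?_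
  filter_upwards [nhdsWithin_mono t₀ sdiff_subset hF] with t ht
  exact F.smul_mem _ (F.sub_mem ht h₀)

end Calculus

/-! ### Lagrangian subspaces. -/

section Linear

variable {V : Type*} [AddCommGroup V] [Module ℝ V] [FiniteDimensional ℝ V]

/-- An isotropic subspace of at least half the dimension is Lagrangian: it has exactly half the
dimension and contains every vector orthogonal to it. -/
theorem lagrangian_of_isotropic {b : LinearMap.BilinForm ℝ V} (hb : b.IsAlt)
    (hn : ∀ v, (∀ w, b v w = 0) → v = 0) {T : Submodule ℝ V} {n : ℕ}
    (hV : Module.finrank ℝ V = 2 * n) (hT : n ≤ Module.finrank ℝ T)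
    (hiso : ∀ u ∈ T, ∀ v ∈ T, b u v = 0) :
    Module.finrank ℝ T = n ∧ ∀ v, (∀ u ∈ T, b v u = 0) → v ∈ T := by
  have hnd : b.Nondegenerate := by
    refine ⟨fun v hv => hn v hv, fun v hv => hn v fun w => ?_⟩
    rw [← hb.neg_eq, hv w, neg_zero]
  have hle : T ≤ b.orthogonal T := fun u hu v hv => hiso v hv u hu
  have hfin := LinearMap.BilinForm.finrank_orthogonal hnd T
  have h1 := Submodule.finrank_mono hle
  have h2 := Submodule.finrank_le T
  -- The orthogonal of `T` has dimension 2n - dim T ≤ n ≤ dim T and contains `T`.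
  have heq : T = b.orthogonal T := Submodule.eq_of_le_of_finrank_eq hle (by omega)
  refine ⟨by omega, fun v hv => ?_⟩
  rw [heq]
  intro u hu
  change b u v = 0
  rw [← hb.neg_eq, hv u hu, neg_zero]

end Linear

theorem hasDerivAt_add_smul {Z : Type*} [NormedAddCommGroup Z] [NormedSpace ℝ Z] (z u : Z) :
    HasDerivAt (fun t : ℝ => z + t • u) u 0 := by
  have h := ((hasDerivAt_id (0 : ℝ)).smul_const u).const_add z
  rw [one_smul] at h
  exact h

/-! ### Tangent vectors and curves of a submanifold in slice charts. -/

section SliceCharts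

variable {E : Type*} [NormedAddCommGroup E] [NormedSpace ℝ E]
  {H : Type*} [TopologicalSpace H] {I : ModelWithCorners ℝ E H}
  {P : Type*} [TopologicalSpace P]
  {φ : OpenPartialHomeomorph P H}

theorem mem_extend_target {p : P} (hp : p ∈ φ.source) : φ.extend I p ∈ (φ.extend I).target :=
  (φ.extend I).map_source (by rwa [φ.extend_source])

theorem extend_symm_extend {p : P} (hp : p ∈ φ.source) :
    (φ.extend I).symm (φ.extend I p) = p :=
  (φ.extend I).left_inv (by rwa [φ.extend_source])

theorem extend_symm_mem_source {y : E} (hy : y ∈ (φ.extend I).target) :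
    (φ.extend I).symm y ∈ φ.source := by
  have := (φ.extend I).map_target hy
  rwa [φ.extend_source] at this

variable [ChartedSpace H P]

theorem contMDiffOn_extend_of_mem (hφ : φ ∈ IsManifold.maximalAtlas I ∞ P) :
    ContMDiffOn I 𝓘(ℝ, E) ∞ (φ.extend I) φ.source :=
  I.contMDiff.comp_contMDiffOn (contMDiffOn_of_mem_maximalAtlas hφ)

theorem contMDiffOn_extend_symm_target (hφ : φ ∈ IsManifold.maximalAtlas I ∞ P) :
    ContMDiffOn 𝓘(ℝ, E) I ∞ (φ.extend I).symm (φ.extend I).target :=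
  (contMDiffOn_extend_symm hφ).mono fun y hy => by
    rw [φ.extend_target] at hy
    exact ⟨I.symm y, hy.1, I.right_inv hy.2⟩

theorem hasMFDerivAt_extend (hφ : φ ∈ IsManifold.maximalAtlas I ∞ P) {p : P}
    (hp : p ∈ φ.source) :
    HasMFDerivAt I 𝓘(ℝ, E) (φ.extend I) p (mfderiv I 𝓘(ℝ, E) (φ.extend I) p) :=
  (((contMDiffOn_extend_of_mem hφ).contMDiffAt
    (φ.open_source.mem_nhds hp)).mdifferentiableAt (by simp)).hasMFDerivAt

/-- The differential of a chart, as a linear map into the model space. -/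
def chartDiff (I : ModelWithCorners ℝ E H) (φ : OpenPartialHomeomorph P H) (p : P) : E →L[ℝ] E :=
  mfderiv I 𝓘(ℝ, E) (φ.extend I) p

/-- The differential of the inverse of a chart at the image of `p`. -/
def chartSymmDiff (I : ModelWithCorners ℝ E H) (φ : OpenPartialHomeomorph P H) (p : P) :
    E →L[ℝ] E :=
  mfderiv 𝓘(ℝ, E) I (φ.extend I).symm (φ.extend I p)

variable {N : Set P} {F : Submodule ℝ E}

/-- In a slice chart, the velocity of a curve in the submanifold lies in the linear slice. -/
theorem chartDiff_velocity_mem [FiniteDimensional ℝ F] (hφ : φ ∈ IsManifold.maximalAtlas I ∞ P)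
    (hF : ∀ y ∈ φ.source, y ∈ N ↔ φ.extend I y ∈ F) {c : ℝ → P} {J : Set ℝ} {t₀ : ℝ}
    (hJ : UniqueDiffWithinAt ℝ J t₀) (ht₀ : t₀ ∈ J) (hp : c t₀ ∈ φ.source)
    (hc : MDifferentiableWithinAt 𝓘(ℝ, ℝ) I c J t₀) (hN : ∀ᶠ t in 𝓝[J] t₀, c t ∈ N) :
    chartDiff I φ (c t₀) (mfderivWithin 𝓘(ℝ, ℝ) I c J t₀ (1 : ℝ)) ∈ F := by
  have h := (hasMFDerivAt_extend hφ hp).comp_hasMFDerivWithinAt t₀ hc.hasMFDerivWithinAt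
  have h' : HasFDerivWithinAt (φ.extend I ∘ c)
      ((chartDiff I φ (c t₀)).comp (mfderivWithin 𝓘(ℝ, ℝ) I c J t₀ : ℝ →L[ℝ] E)) J t₀ :=
    h.hasFDerivWithinAt
  have hev : ∀ᶠ t in 𝓝[J] t₀, (φ.extend I ∘ c) t ∈ F := by
    filter_upwards [hN, hc.continuousWithinAt (φ.open_source.mem_nhds hp)] with t h1 h2
    exact (hF _ h2).1 h1
  exact derivWithin_mem_of_eventually_mem hJ h'.hasDerivWithinAt (hev.self_of_nhdsWithin ht₀) hev

variable [I.Boundaryless]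

theorem hasMFDerivAt_extend_symm (hφ : φ ∈ IsManifold.maximalAtlas I ∞ P) {y : E}
    (hy : y ∈ (φ.extend I).target) :
    HasMFDerivAt 𝓘(ℝ, E) I (φ.extend I).symm y (mfderiv 𝓘(ℝ, E) I (φ.extend I).symm y) :=
  (((contMDiffOn_extend_symm_target hφ).contMDiffAt
    (φ.isOpen_extend_target.mem_nhds hy)).mdifferentiableAt (by simp)).hasMFDerivAt

/-- Without boundary the target of the chart is open, so the chart composed with its inverse is the
identity near the image of `p`, and the chain rule applies. -/
theorem chartDiff_chartSymmDiff (hφ : φ ∈ IsManifold.maximalAtlas I ∞ P) {p : P}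
    (hp : p ∈ φ.source) (u : E) : chartDiff I φ p (chartSymmDiff I φ p u) = u := by
  have hy := mem_extend_target (I := I) hp
  have h1 := hasMFDerivAt_extend_symm hφ hy
  have h2 := hasMFDerivAt_extend hφ (extend_symm_mem_source (I := I) hy)
  have h3 := h2.comp _ h1
  have h4 : HasMFDerivAt 𝓘(ℝ, E) 𝓘(ℝ, E) (φ.extend I ∘ (φ.extend I).symm) (φ.extend I p)
      (ContinuousLinearMap.id ℝ (TangentSpace 𝓘(ℝ, E) (φ.extend I p))) :=
    (hasMFDerivAt_id _).congr_of_eventuallyEq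
      (Filter.eventually_of_mem (φ.isOpen_extend_target.mem_nhds hy)
        fun y hy => (φ.extend I).right_inv hy)
  have h5 := hasMFDerivAt_unique h3 h4
  have h6 := congrArg (fun A : E →L[ℝ] E => A u) h5
  have h7 : chartDiff I φ ((φ.extend I).symm (φ.extend I p)) (chartSymmDiff I φ p u) = u := h6
  rwa [extend_symm_extend hp] at h7

theorem chartSymmDiff_chartDiff (hφ : φ ∈ IsManifold.maximalAtlas I ∞ P) {p : P}
    (hp : p ∈ φ.source) (v : E) : chartSymmDiff I φ p (chartDiff I φ p v) = v := by
  have h1 := hasMFDerivAt_extend hφ hp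
  have h2 := hasMFDerivAt_extend_symm hφ (mem_extend_target (I := I) hp)
  have h3 := h2.comp _ h1
  have h4 : HasMFDerivAt I I ((φ.extend I).symm ∘ φ.extend I) p
      (ContinuousLinearMap.id ℝ (TangentSpace I p)) :=
    (hasMFDerivAt_id _).congr_of_eventuallyEq
      (Filter.eventually_of_mem (φ.open_source.mem_nhds hp)
        fun y hy => extend_symm_extend hy)
  have h5 := hasMFDerivAt_unique h3 h4
  exact congrArg (fun A : E →L[ℝ] E => A v) h5

/-- In a slice chart, every vector of the linear slice is the velocity of a curve in the
submanifold. -/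
theorem chartSymmDiff_mem_curveVelocities (hφ : φ ∈ IsManifold.maximalAtlas I ∞ P)
    (hF : ∀ y ∈ φ.source, y ∈ N ↔ φ.extend I y ∈ F) {p : P} (hp : p ∈ φ.source) (hpN : p ∈ N)
    {u : E} (hu : u ∈ F) : chartSymmDiff I φ p u ∈ curveVelocities I N p := by
  set z := φ.extend I p with hz
  set q : ℝ → E := fun t => z + t • u with hq
  have hqs : ContDiff ℝ ∞ q := by fun_prop
  have hq0 : q 0 = z := by simp [hq]
  have hzF : z ∈ F := (hF p hp).1 hpN
  have hmem : (0 : ℝ) ∈ q ⁻¹' (φ.extend I).target := by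
    rw [mem_preimage, hq0]
    exact mem_extend_target hp
  obtain ⟨ε, hε, hball⟩ := Metric.isOpen_iff.1
    (φ.isOpen_extend_target.preimage hqs.continuous) 0 hmem
  rw [Real.ball_eq_Ioo, zero_sub, zero_add] at hball
  refine ⟨fun t => (φ.extend I).symm (q t), ε, hε,
    (contMDiffOn_extend_symm_target hφ).comp hqs.contMDiff.contMDiffOn hball,
    fun t ht => ?_, ?_, ?_⟩
  · refine (hF _ (extend_symm_mem_source (hball ht))).2 ?_
    rw [(φ.extend I).right_inv (hball ht)]
    exact F.add_mem hzF (F.smul_mem _ hu)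
  · simp only [hq0]
    exact extend_symm_extend hp
  · have hqd : HasDerivAt q u 0 := hasDerivAt_add_smul z u
    have h1 := hasMFDerivAt_extend_symm hφ hmem
    have h2 := h1.comp (0 : ℝ) hqd.hasFDerivAt.hasMFDerivAt
    have h3 := congrArg (fun A : ℝ →L[ℝ] E => A (1 : ℝ)) h2.mfderiv
    refine Eq.trans ?_ h3.symm
    change chartSymmDiff I φ p u
      = (mfderiv 𝓘(ℝ, E) I (φ.extend I).symm (q 0) : E →L[ℝ] E) ((1 : ℝ) • u)
    rw [hq0, one_smul]
    rfl

/-- The tangent space of a `k`-dimensional submanifold has dimension at least `k`. -/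
theorem IsSubmanifold.le_finrank_tangentSubspace [FiniteDimensional ℝ E] {k : ℕ}
    (hN : IsSubmanifold I k N) {p : P} (hp : p ∈ N) :
    k ≤ Module.finrank ℝ (tangentSubspace I N p) := by
  obtain ⟨φ, hφ, hpφ, F, hk, hF⟩ := hN p hp
  have hinj : Function.Injective (chartSymmDiff I φ p) :=
    Function.LeftInverse.injective (chartDiff_chartSymmDiff hφ hpφ)
  have : FiniteDimensional ℝ (TangentSpace I p) := inferInstanceAs (FiniteDimensional ℝ E)
  let A : E →ₗ[ℝ] TangentSpace I p := (chartSymmDiff I φ p).toLinearMap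
  have hA : Function.Injective A := hinj
  have hle : F.map A ≤ tangentSubspace I N p := by
    rintro _ ⟨u, hu, rfl⟩
    exact Submodule.subset_span (chartSymmDiff_mem_curveVelocities hφ hF hpφ hp hu)
  rw [← hk, (Submodule.equivMapOfInjective A hA F).finrank_eq]
  exact Submodule.finrank_mono hle

/-- In a slice chart, given a smooth function `h` whose differential does not vanish on the
tangent vector corresponding to `w`, every tangent vector is the velocity of a curve in the
submanifold along which `h` is affine. -/
theorem exists_curve_affine_of_slice (hφ : φ ∈ IsManifold.maximalAtlas I ∞ P)
    (hF : ∀ y ∈ φ.source, y ∈ N ↔ φ.extend I y ∈ F) {p : P} (hp : p ∈ φ.source) (hpN : p ∈ N)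
    {W : Set P} (hW : IsOpen W) (hpW : p ∈ W) {h : P → ℝ} (hh : ContMDiff I 𝓘(ℝ, ℝ) ∞ h)
    {u w : E} (hu : u ∈ F) (hw : w ∈ F)
    (hne : fderiv ℝ (h ∘ (φ.extend I).symm) (φ.extend I p) w ≠ 0) :
    ∃ ε > 0, ∃ c : ℝ → P, ContMDiffOn 𝓘(ℝ, ℝ) I ∞ c (Ioo (-ε) ε) ∧ c 0 = p ∧
      (∀ t ∈ Ioo (-ε) ε, c t ∈ N ∩ W ∧
        h (c t) = h p + t * fderiv ℝ (h ∘ (φ.extend I).symm) (φ.extend I p) u) ∧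
      (mfderiv 𝓘(ℝ, ℝ) I c 0 (1 : ℝ) : E) = chartSymmDiff I φ p u := by
  set z := φ.extend I p with hz
  have hzF : z ∈ F := (hF p hp).1 hpN
  have hsymm := contMDiffOn_extend_symm_target hφ
  set O : Set E := (φ.extend I).target ∩ (φ.extend I).symm ⁻¹' W with hO
  have hOo : IsOpen O := hsymm.continuousOn.isOpen_inter_preimage φ.isOpen_extend_target hW
  have hzO : z ∈ O := ⟨mem_extend_target hp, by
    rw [mem_preimage, extend_symm_extend hp]; exact hpW⟩
  have hfs : ContDiffOn ℝ ∞ (h ∘ (φ.extend I).symm) O :=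
    ((hh.comp_contMDiffOn hsymm).mono inter_subset_left).contDiffOn
  obtain ⟨ε, hε, a, ha, ha0, had, haO⟩ := exists_affine_level_curve hOo hfs hzO u w hne
  set q : ℝ → E := fun t => z + t • u + a t • w with hq
  have hq0 : q 0 = z := by simp [hq, ha0]
  have hqs : ContDiffOn ℝ ∞ q (Ioo (-ε) ε) := by
    have : ContDiff ℝ ∞ (fun t : ℝ => z + t • u) := by fun_prop
    exact this.contDiffOn.add (ha.smul contDiffOn_const)
  have hqd : HasDerivAt q u 0 := by
    have h := (hasDerivAt_add_smul z u).add (had.smul_const w)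
    rw [zero_smul, add_zero] at h
    exact h
  refine ⟨ε, hε, fun t => (φ.extend I).symm (q t),
    hsymm.comp hqs.contMDiffOn fun t ht => (haO t ht).1.1, ?_, fun t ht => ⟨⟨?_, ?_⟩, ?_⟩, ?_⟩
  · simp only [hq0]
    exact extend_symm_extend hp
  · refine (hF _ (extend_symm_mem_source (haO t ht).1.1)).2 ?_
    rw [(φ.extend I).right_inv (haO t ht).1.1]
    exact F.add_mem (F.add_mem hzF (F.smul_mem _ hu)) (F.smul_mem _ hw)
  · exact (haO t ht).1.2
  · have := (haO t ht).2
    simp only [Function.comp_apply] at this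
    rw [this]
    congr 2
    exact extend_symm_extend hp
  · have h1 := hasMFDerivAt_extend_symm hφ (y := q 0) (by rw [hq0]; exact hzO.1)
    have h2 := h1.comp (0 : ℝ) hqd.hasFDerivAt.hasMFDerivAt
    have h3 := congrArg (fun A : ℝ →L[ℝ] E => A (1 : ℝ)) h2.mfderiv
    refine h3.trans ?_
    change (mfderiv 𝓘(ℝ, E) I (φ.extend I).symm (q 0) : E →L[ℝ] E) ((1 : ℝ) • u) = _
    rw [hq0, one_smul]
    rfl

end SliceCharts

section SliceFunctions

variable {E : Type*} [NormedAddCommGroup E] [NormedSpace ℝ E]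
  {H : Type*} [TopologicalSpace H] {I : ModelWithCorners ℝ E H} [I.Boundaryless]
  {P : Type*} [TopologicalSpace P] [ChartedSpace H P]
  {φ : OpenPartialHomeomorph P H}

theorem fderiv_comp_extend_symm (hφ : φ ∈ IsManifold.maximalAtlas I ∞ P) {p : P}
    (hp : p ∈ φ.source) {h : P → ℝ} (hh : ContMDiff I 𝓘(ℝ, ℝ) ∞ h) (u : E) :
    fderiv ℝ (h ∘ (φ.extend I).symm) (φ.extend I p) u
      = (mfderiv I 𝓘(ℝ, ℝ) h p : E →L[ℝ] ℝ) (chartSymmDiff I φ p u) := by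
  have h1 := hasMFDerivAt_extend_symm hφ (mem_extend_target (I := I) hp)
  have h2 := ((hh.mdifferentiable (by simp))
    ((φ.extend I).symm (φ.extend I p))).hasMFDerivAt
  have h3 := h2.comp _ h1
  let dh : P → E →L[ℝ] ℝ := fun q => mfderiv I 𝓘(ℝ, ℝ) h q
  have h4 : HasFDerivAt (h ∘ (φ.extend I).symm)
      ((dh ((φ.extend I).symm (φ.extend I p))).comp (chartSymmDiff I φ p)) (φ.extend I p) :=
    h3.hasFDerivAt
  rw [h4.fderiv, extend_symm_extend hp]
  rfl

end SliceFunctions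

/-! ### Slices of the total space, `L`-paths and their velocities. -/

section Families

variable {E : Type*} [NormedAddCommGroup E] [NormedSpace ℝ E]
  {M : Type*} [TopologicalSpace M] [ChartedSpace E M]
  {J : Set ℝ} {L : ℝ → Set M}

/-- Translates "not vertical" for a tangent vector of M × ℝ into the nonvanishing derivative
required by `exists_curve_affine_of_slice`. -/
theorem fderiv_snd_comp_extend_symm {φ : OpenPartialHomeomorph (M × ℝ) (ModelProd E ℝ)}
    (hφ : φ ∈ IsManifold.maximalAtlas (𝓘(ℝ, E).prod 𝓘(ℝ, ℝ)) ∞ (M × ℝ)) {p : M × ℝ}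
    (hp : p ∈ φ.source) (u : E × ℝ) :
    fderiv ℝ (Prod.snd ∘ (φ.extend (𝓘(ℝ, E).prod 𝓘(ℝ, ℝ))).symm)
        (φ.extend (𝓘(ℝ, E).prod 𝓘(ℝ, ℝ)) p) u
      = (chartSymmDiff (𝓘(ℝ, E).prod 𝓘(ℝ, ℝ)) φ p u).2 := by
  rw [fderiv_comp_extend_symm hφ hp contMDiff_snd, mfderiv_snd]
  rfl

variable (E J L) in
/-- Slice data for the total space of a family near `(x, s₀)`: a chart `φ` of `M × ℝ` and a
subspace `F` that describe the total space over `J` in the neighbourhood `W`, and a vector `w` of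
`F` that is not vertical at `p`. -/
structure SubmersiveSlice (p : M × ℝ) where
  W : Set (M × ℝ)
  isOpen : IsOpen W
  N : Set (M × ℝ)
  mem_iff : ∀ q ∈ W, q.2 ∈ J → (q ∈ N ↔ q.1 ∈ L q.2)
  φ : OpenPartialHomeomorph (M × ℝ) (ModelProd E ℝ)
  mem_atlas : φ ∈ IsManifold.maximalAtlas (𝓘(ℝ, E).prod 𝓘(ℝ, ℝ)) ∞ (M × ℝ)
  F : Submodule ℝ (E × ℝ)
  slice : ∀ y ∈ φ.source, y ∈ N ↔ φ.extend (𝓘(ℝ, E).prod 𝓘(ℝ, ℝ)) y ∈ F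
  w : E × ℝ
  w_mem : w ∈ F
  mem_W : p ∈ W
  mem_source : p ∈ φ.source
  transverse : (chartSymmDiff (𝓘(ℝ, E).prod 𝓘(ℝ, ℝ)) φ p w).2 ≠ 0

theorem IsSubmersiveSubmanifold.nonempty_slice [FiniteDimensional ℝ E]
    (hL : IsSubmersiveSubmanifold E J L) {p : M × ℝ} (hp : p ∈ totalSet J L) :
    Nonempty (SubmersiveSlice E J L p) := by
  obtain ⟨W, hW, hpW, k, N, hN, heq, hsub⟩ := hL p hp
  have hmem : ∀ q ∈ W, q.2 ∈ J → (q ∈ N ↔ q.1 ∈ L q.2) := fun q hq hqJ => by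
    have h : q ∈ totalSet J L ∩ W ↔ q ∈ N ∩ (univ ×ˢ J) ∩ W := by rw [heq]
    simp only [mem_inter_iff, hq, and_true, mem_prod, mem_univ, hqJ] at h
    rw [← h]
    exact ⟨fun h => h.2, fun h => ⟨hqJ, h⟩⟩
  have hpN : p ∈ N := (hmem p hpW hp.1).2 hp.2
  obtain ⟨φ, hφ, hpφ, F, -, hF⟩ := hN p hpN
  obtain ⟨v, hv, hv2⟩ : ∃ v ∈ curveVelocities (𝓘(ℝ, E).prod 𝓘(ℝ, ℝ)) N p,
      (v : E × ℝ).2 ≠ 0 := by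
    -- Surjectivity is given on the span of the velocities, but membership in the slice is known for
    -- individual velocities. If every velocity were vertical, so would be their span.
    by_contra! hcon
    obtain ⟨⟨v, hv⟩, h1⟩ := hsub p ⟨hp, hpW⟩ (1 : ℝ)
    have hle : tangentSubspace (𝓘(ℝ, E).prod 𝓘(ℝ, ℝ)) N p
        ≤ LinearMap.ker (mfderiv (𝓘(ℝ, E).prod 𝓘(ℝ, ℝ)) 𝓘(ℝ, ℝ) (Prod.snd : M × ℝ → ℝ) p
          ).toLinearMap := by
      refine Submodule.span_le.2 fun u hu => ?_
      have h2 : mfderiv (𝓘(ℝ, E).prod 𝓘(ℝ, ℝ)) 𝓘(ℝ, ℝ) (Prod.snd : M × ℝ → ℝ) p u = 0 := by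
        rw [mfderiv_snd]
        exact hcon u hu
      exact h2
    have h3 : mfderiv (𝓘(ℝ, E).prod 𝓘(ℝ, ℝ)) 𝓘(ℝ, ℝ) (Prod.snd : M × ℝ → ℝ) p v = (0 : ℝ) :=
      hle hv
    exact one_ne_zero (α := ℝ) (h1.symm.trans h3)
  refine ⟨⟨W, hW, N, hmem, φ, hφ, F, hF, chartDiff (𝓘(ℝ, E).prod 𝓘(ℝ, ℝ)) φ p v, ?_, hpW, hpφ, ?_⟩⟩
  · obtain ⟨c, ε, hε, hc, hcN, rfl, hvc⟩ := hv
    have hnhds : Ioo (-ε) ε ∈ 𝓝 (0 : ℝ) := Ioo_mem_nhds (by linarith) hε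
    have h1 := chartDiff_velocity_mem hφ hF (c := c) (J := univ) (t₀ := 0)
      uniqueDiffWithinAt_univ (mem_univ _) hpφ
      ((hc.contMDiffAt hnhds).mdifferentiableAt (by simp)).mdifferentiableWithinAt
      (by rw [nhdsWithin_univ]; exact Filter.eventually_of_mem hnhds hcN)
    rw [mfderivWithin_univ] at h1
    have h2 : v = mfderiv 𝓘(ℝ, ℝ) (𝓘(ℝ, E).prod 𝓘(ℝ, ℝ)) c 0 (1 : ℝ) := hvc
    rw [h2]
    exact h1
  · have h := chartSymmDiff_chartDiff hφ hpφ v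
    exact fun h0 => hv2 ((congrArg Prod.snd h).symm.trans h0)

namespace SubmersiveSlice

variable {p : M × ℝ} (S : SubmersiveSlice E J L p)

/-- The chart of a slice, as a map to the model vector space. -/
abbrev chart : PartialEquiv (M × ℝ) (E × ℝ) := S.φ.extend (𝓘(ℝ, E).prod 𝓘(ℝ, ℝ))

/-- The slice vector `w`, normalized to have `ℝ`-component `1`, as a vector field in the chart. -/
def unitField (ζ : E × ℝ) : E × ℝ := (fderiv ℝ (Prod.snd ∘ S.chart.symm) ζ S.w)⁻¹ • S.w

/-- The vector field on `M` whose value at `y` is the `M`-component of the unit field at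
`(y, s₀)`. -/
def velocityField (s₀ : ℝ) (y : M) : E :=
  (chartSymmDiff (𝓘(ℝ, E).prod 𝓘(ℝ, ℝ)) S.φ (y, s₀) (S.unitField (S.chart (y, s₀)))).1

/-- The points of the target of the chart at which `w` is not vertical. -/
def regularTarget : Set (E × ℝ) :=
  S.chart.target ∩ (fun ζ => fderiv ℝ (Prod.snd ∘ S.chart.symm) ζ S.w) ⁻¹' {0}ᶜ

theorem contDiffOn_snd_comp_symm : ContDiffOn ℝ ∞ (Prod.snd ∘ S.chart.symm) S.chart.target :=
  (contMDiff_snd.comp_contMDiffOn (contMDiffOn_extend_symm_target S.mem_atlas)).contDiffOn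

theorem contDiffOn_fderiv_snd :
    ContDiffOn ℝ ∞ (fun ζ => fderiv ℝ (Prod.snd ∘ S.chart.symm) ζ S.w) S.chart.target :=
  (S.contDiffOn_snd_comp_symm.fderiv_of_isOpen S.φ.isOpen_extend_target (by simp)).clm_apply
    contDiffOn_const

theorem isOpen_regularTarget : IsOpen S.regularTarget :=
  S.contDiffOn_fderiv_snd.continuousOn.isOpen_inter_preimage S.φ.isOpen_extend_target
    isOpen_compl_singleton

theorem contDiffOn_unitField : ContDiffOn ℝ ∞ S.unitField S.regularTarget :=
  ((S.contDiffOn_fderiv_snd.mono inter_subset_left).inv fun _ h => h.2).smul contDiffOn_const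

/-- The points of `M` near which the velocity field at time `s₀` is defined. -/
def domain (s₀ : ℝ) : Set M :=
  (fun y => (y, s₀)) ⁻¹' (S.W ∩ (S.φ.source ∩ S.chart ⁻¹' S.regularTarget))

theorem isOpen_domain (s₀ : ℝ) : IsOpen (S.domain s₀) :=
  (S.isOpen.inter ((contMDiffOn_extend_of_mem S.mem_atlas).continuousOn.isOpen_inter_preimage
    S.φ.open_source S.isOpen_regularTarget)).preimage (by fun_prop)

theorem mem_domain : p.1 ∈ S.domain p.2 := by
  refine ⟨S.mem_W, S.mem_source, mem_extend_target S.mem_source, ?_⟩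
  change fderiv ℝ (Prod.snd ∘ S.chart.symm) (S.chart p) S.w ≠ 0
  rw [fderiv_snd_comp_extend_symm S.mem_atlas S.mem_source]
  exact S.transverse

/-- The field is a composite of smooth maps: y ↦ chart (y, s₀), then the unit field as a section of
the tangent bundle of the model space, then the tangent map of the M-component of the inverse chart.
-/
theorem contMDiffOn_velocityField [IsManifold 𝓘(ℝ, E) ∞ M] (s₀ : ℝ) :
    ContMDiffOn 𝓘(ℝ, E) 𝓘(ℝ, E).tangent ∞
      (fun y => (⟨y, S.velocityField s₀ y⟩ : TangentBundle 𝓘(ℝ, E) M)) (S.domain s₀) := by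
  have : IsManifold 𝓘(ℝ, E) 1 M := IsManifold.of_le (n := ∞) (by simp)
  set g : E × ℝ → M := Prod.fst ∘ S.chart.symm with hg
  have hgs : ContMDiffOn 𝓘(ℝ, E × ℝ) 𝓘(ℝ, E) ∞ g S.regularTarget :=
    (contMDiff_fst.comp_contMDiffOn (contMDiffOn_extend_symm_target S.mem_atlas)).mono
      inter_subset_left
  have h1 := hgs.contMDiffOn_tangentMapWithin (m := ∞) (by simp)
    S.isOpen_regularTarget.uniqueMDiffOn
  have h2 : ContMDiffOn 𝓘(ℝ, E × ℝ) 𝓘(ℝ, E × ℝ).tangent ∞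
      (fun ζ => (⟨ζ, S.unitField ζ⟩ : TangentBundle 𝓘(ℝ, E × ℝ) (E × ℝ))) S.regularTarget :=
    contMDiffOn_vectorSpace_iff_contDiffOn.2 S.contDiffOn_unitField
  have h3 : ContMDiffOn 𝓘(ℝ, E) 𝓘(ℝ, E × ℝ) ∞ (fun y : M => S.chart (y, s₀)) (S.domain s₀) :=
    (contMDiffOn_extend_of_mem S.mem_atlas).comp
      (contMDiff_id.prodMk contMDiff_const).contMDiffOn fun y hy => hy.2.1
  refine ((h1.comp h2 fun ζ hζ => hζ).comp h3 fun y hy => hy.2.2).congr fun y hy => ?_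
  have hsrc : (y, s₀) ∈ S.φ.source := hy.2.1
  have hgy : g (S.chart (y, s₀)) = y := congrArg Prod.fst (extend_symm_extend hsrc)
  have hd : (mfderivWithin 𝓘(ℝ, E × ℝ) 𝓘(ℝ, E) g S.regularTarget (S.chart (y, s₀)) :
      E × ℝ →L[ℝ] E) (S.unitField (S.chart (y, s₀))) = S.velocityField s₀ y := by
    rw [mfderivWithin_of_isOpen S.isOpen_regularTarget hy.2.2]
    have h4 := hasMFDerivAt_extend_symm S.mem_atlas hy.2.2.1
    have h5 := (hasMFDerivAt_fst (I := 𝓘(ℝ, E)) (I' := 𝓘(ℝ, ℝ))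
      (x := S.chart.symm (S.chart (y, s₀)))).comp _ h4
    exact congrArg (fun A : E × ℝ →L[ℝ] E => A (S.unitField (S.chart (y, s₀)))) h5.mfderiv
  -- The composite has base point g (chart (y, s₀)), which equals y only propositionally; both
  -- components of the bundle point are therefore replaced together.
  have key : ∀ (y' : M) (v' : E), y' = y → v' = S.velocityField s₀ y →
      (⟨y, S.velocityField s₀ y⟩ : TangentBundle 𝓘(ℝ, E) M) = ⟨y', v'⟩ := by
    rintro _ _ rfl rfl
    rfl
  exact key _ _ hgy hd

/-- The velocity field consists of velocities of `L`-paths. -/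
theorem velocityField_mem_pathVelocities {s₀ : ℝ} (hJ : UniqueDiffWithinAt ℝ J s₀) (hs₀ : s₀ ∈ J)
    {y : M} (hy : y ∈ S.domain s₀) (hyL : y ∈ L s₀) :
    S.velocityField s₀ y ∈ pathVelocities E J L s₀ y := by
  obtain ⟨hyW, hyφ, hyt, hyw⟩ := hy
  have hyw' : fderiv ℝ (Prod.snd ∘ S.chart.symm) (S.chart (y, s₀)) S.w ≠ 0 := hyw
  have hyN : (y, s₀) ∈ S.N := (S.mem_iff _ hyW hs₀).2 hyL
  have hunit : S.unitField (S.chart (y, s₀)) ∈ S.F := S.F.smul_mem _ S.w_mem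
  obtain ⟨ε, hε, c, hc, hc0, hcN, hcv⟩ := exists_curve_affine_of_slice S.mem_atlas S.slice hyφ hyN
    S.isOpen hyW contMDiff_snd hunit S.w_mem hyw'
  -- Speed 1 in the ℝ-direction, starting at s₀, makes `c (s - s₀)` lie over the parameter s itself.
  have hone : fderiv ℝ (Prod.snd ∘ S.chart.symm) (S.chart (y, s₀))
      (S.unitField (S.chart (y, s₀))) = 1 := by
    rw [unitField, map_smul, smul_eq_mul, inv_mul_cancel₀ hyw']
  have hmaps : ∀ s ∈ Ioo (s₀ - ε) (s₀ + ε), s - s₀ ∈ Ioo (-ε) ε := fun s hs =>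
    ⟨by linarith [hs.1], by linarith [hs.2]⟩
  have hsub : ContDiff ℝ ∞ (fun s : ℝ => s - s₀) := by fun_prop
  refine ⟨fun s => (c (s - s₀)).1, ε, hε, ?_, fun s hs => ?_, by simp [hc0], ?_⟩
  · exact (contMDiff_fst.comp_contMDiffOn
      (hc.comp hsub.contMDiff.contMDiffOn hmaps)).mono inter_subset_right
  · obtain ⟨⟨h1, h2⟩, h3⟩ := hcN _ (hmaps s hs.2)
    have h4 : (c (s - s₀)).2 = s := by
      rw [h3]
      erw [hone]
      simp
    -- The curve `c` runs on both sides of s₀ even at an endpoint of `J`; `N` describes the family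
    -- only over `J`, so only that part of the curve is used.
    have h5 := (S.mem_iff _ h2 (by rw [h4]; exact hs.1)).1 h1
    rwa [h4] at h5
  · have hnhds : Ioo (-ε) ε ∈ 𝓝 (s₀ - s₀) := by
      rw [sub_self]
      exact Ioo_mem_nhds (by linarith) hε
    have h1 := ((hc.contMDiffAt hnhds).mdifferentiableAt (by simp)).hasMFDerivAt
    have h2 : HasDerivAt (fun s : ℝ => s - s₀) 1 s₀ := (hasDerivAt_id s₀).sub_const s₀
    have h3 := (hasMFDerivAt_fst (I := 𝓘(ℝ, E)) (I' := 𝓘(ℝ, ℝ)) (x := c (s₀ - s₀))).comp s₀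
      (HasMFDerivAt.comp (f := fun s : ℝ => s - s₀) s₀ h1 h2.hasFDerivAt.hasMFDerivAt)
    have h4 := congrArg (fun A : ℝ →L[ℝ] E => A (1 : ℝ))
      (h3.hasMFDerivWithinAt.mfderivWithin (s := J) hJ.uniqueMDiffWithinAt)
    refine Eq.trans ?_ h4.symm
    change S.velocityField s₀ y = ((mfderiv 𝓘(ℝ, ℝ) (𝓘(ℝ, E).prod 𝓘(ℝ, ℝ)) c (s₀ - s₀) :
      ℝ →L[ℝ] E × ℝ) ((1 : ℝ) • 1)).1
    rw [sub_self, one_smul]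
    exact (congrArg Prod.fst hcv).symm

/-- The velocities of two `L`-paths through the same point differ by a tangent vector. -/
theorem sub_mem_tangentSubspace [FiniteDimensional ℝ E] {s₀ : ℝ} {x : M}
    (S : SubmersiveSlice E J L (x, s₀)) (hJ : UniqueDiffWithinAt ℝ J s₀) (hs₀ : s₀ ∈ J)
    {v₁ v₂ : TangentSpace 𝓘(ℝ, E) x} (h₁ : v₁ ∈ pathVelocities E J L s₀ x)
    (h₂ : v₂ ∈ pathVelocities E J L s₀ x) : v₁ - v₂ ∈ tangentSubspace 𝓘(ℝ, E) (L s₀) x := by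
  -- The graph s ↦ (γ s, s) of an `L`-path lies in the slice, so its velocity (v, 1) corresponds to
  -- a vector of `F`. Subtracting two of these leaves the vertical vector (v₁ - v₂, 0).
  have hlift : ∀ v ∈ pathVelocities E J L s₀ x,
      x ∈ L s₀ ∧ chartDiff (𝓘(ℝ, E).prod 𝓘(ℝ, ℝ)) S.φ (x, s₀) ((v, (1 : ℝ)) : E × ℝ) ∈ S.F := by
    rintro v ⟨γ, ε, hε, hγ, hγL, rfl, hv⟩
    have hnhds : Ioo (s₀ - ε) (s₀ + ε) ∈ 𝓝 s₀ := Ioo_mem_nhds (by linarith) (by linarith)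
    have hs₀' : s₀ ∈ J ∩ Ioo (s₀ - ε) (s₀ + ε) := ⟨hs₀, mem_of_mem_nhds hnhds⟩
    refine ⟨hγL _ hs₀', ?_⟩
    have hγd : MDifferentiableWithinAt 𝓘(ℝ, ℝ) 𝓘(ℝ, E) γ J s₀ :=
      (mdifferentiableWithinAt_inter hnhds).1 ((hγ _ hs₀').mdifferentiableWithinAt (by simp))
    have hΓ := hγd.hasMFDerivWithinAt.prodMk (hasMFDerivWithinAt_id (I := 𝓘(ℝ, ℝ)) (s := J) s₀)
    have hW : ∀ᶠ s in 𝓝[J] s₀, (γ s, s) ∈ S.W :=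
      hΓ.continuousWithinAt (S.isOpen.mem_nhds S.mem_W)
    have hN : ∀ᶠ s in 𝓝[J] s₀, (γ s, s) ∈ S.N := by
      filter_upwards [hW, self_mem_nhdsWithin, nhdsWithin_le_nhds hnhds] with s a b d
      exact (S.mem_iff _ a b).2 (hγL s ⟨b, d⟩)
    have h3 := chartDiff_velocity_mem S.mem_atlas S.slice (c := fun s => (γ s, s)) hJ hs₀
      S.mem_source hΓ.mdifferentiableWithinAt hN
    have h4 := congrArg (fun A : ℝ →L[ℝ] E × ℝ => A (1 : ℝ))
      (hΓ.mfderivWithin hJ.uniqueMDiffWithinAt)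
    have h5 : ((v, (1 : ℝ)) : E × ℝ)
        = (mfderivWithin 𝓘(ℝ, ℝ) (𝓘(ℝ, E).prod 𝓘(ℝ, ℝ)) (fun s => (γ s, s)) J s₀ :
          ℝ →L[ℝ] E × ℝ) 1 := by
      refine Eq.trans ?_ h4.symm
      exact Prod.ext hv rfl
    rw [h5]
    exact h3
  obtain ⟨hxL, hu₁⟩ := hlift v₁ h₁
  obtain ⟨-, hu₂⟩ := hlift v₂ h₂
  have hu := S.F.sub_mem hu₁ hu₂
  rw [← map_sub] at hu
  set u := chartDiff (𝓘(ℝ, E).prod 𝓘(ℝ, ℝ)) S.φ (x, s₀)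
    (((v₁, (1 : ℝ)) : E × ℝ) - ((v₂, (1 : ℝ)) : E × ℝ)) with hudef
  have hsu : chartSymmDiff (𝓘(ℝ, E).prod 𝓘(ℝ, ℝ)) S.φ (x, s₀) u
      = ((v₁, (1 : ℝ)) : E × ℝ) - ((v₂, (1 : ℝ)) : E × ℝ) :=
    chartSymmDiff_chartDiff S.mem_atlas S.mem_source _
  have hne : fderiv ℝ (Prod.snd ∘ S.chart.symm) (S.chart (x, s₀)) S.w ≠ 0 := by
    rw [fderiv_snd_comp_extend_symm S.mem_atlas S.mem_source]
    exact S.transverse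
  have hzero : fderiv ℝ (Prod.snd ∘ S.chart.symm) (S.chart (x, s₀)) u = 0 := by
    rw [fderiv_snd_comp_extend_symm S.mem_atlas S.mem_source, hsu]
    exact sub_self (1 : ℝ)
  -- With slope zero the ℝ-component of the curve is constantly s₀, so its M-component stays in `L
  -- s₀`.
  obtain ⟨ε, hε, c, hc, hc0, hcN, hcv⟩ := exists_curve_affine_of_slice S.mem_atlas S.slice
    S.mem_source ((S.mem_iff _ S.mem_W hs₀).2 hxL) S.isOpen S.mem_W contMDiff_snd hu S.w_mem hne
  refine Submodule.subset_span ⟨fun t => (c t).1, ε, hε, contMDiff_fst.comp_contMDiffOn hc,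
    fun t ht => ?_, by simp [hc0], ?_⟩
  · obtain ⟨⟨h1, h2⟩, h3⟩ := hcN t ht
    have h4 : (c t).2 = s₀ := by
      rw [h3]
      erw [hzero]
      simp
    have h5 := (S.mem_iff _ h2 (by rw [h4]; exact hs₀)).1 h1
    rwa [h4] at h5
  · have hnhds : Ioo (-ε) ε ∈ 𝓝 (0 : ℝ) := Ioo_mem_nhds (by linarith) hε
    have h1 := ((hc.contMDiffAt hnhds).mdifferentiableAt (by simp)).hasMFDerivAt
    have h3 := (hasMFDerivAt_fst (I := 𝓘(ℝ, E)) (I' := 𝓘(ℝ, ℝ)) (x := c 0)).comp (0 : ℝ) h1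
    have h4 := congrArg (fun A : ℝ →L[ℝ] E => A (1 : ℝ)) h3.mfderiv
    refine Eq.trans ?_ h4.symm
    exact (congrArg Prod.fst (hcv.trans hsu)).symm

end SubmersiveSlice
end Families

/-! ### Homogeneity of normal sections and of the corresponding 1-forms. -/

section Lagrangian

variable {E : Type*} [NormedAddCommGroup E] [NormedSpace ℝ E]
  {M : Type*} [TopologicalSpace M] [ChartedSpace E M] [IsManifold 𝓘(ℝ, E) ∞ M]
  {Ω : BilinField E M} {N : Set M}

/-- Since h_z^* Ω = z Ω with z ≠ 0, a vector killed by the differential is Ω-orthogonal to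
everything. -/
theorem dAction_injective [MulAction ℝˣ M] (hΩ : IsSymplectic Ω) (hh : IsHomogeneousBilin 1 Ω) (z : ℝˣ) (x : M) :
    Function.Injective (dAction E z x) := by
  refine (injective_iff_map_eq_zero _).2 fun v hv => hΩ.nondegenerate x v fun w => ?_
  have h := hh z x v w
  rw [hv, map_zero, zpow_one] at h
  exact (mul_eq_zero.1 h.symm).resolve_left z.ne_zero

variable [FiniteDimensional ℝ E]

/-- The tangent spaces of a Lagrangian submanifold have half the dimension and contain every vector
that is orthogonal to them. -/
theorem IsLagrangian.tangentSubspace_maximal (hN : IsLagrangian Ω N) (hΩ : IsSymplectic Ω)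
    {x : M} (hx : x ∈ N) :
    2 * Module.finrank ℝ (tangentSubspace 𝓘(ℝ, E) N x) = Module.finrank ℝ E ∧
      ∀ v : TangentSpace 𝓘(ℝ, E) x, (∀ u ∈ tangentSubspace 𝓘(ℝ, E) N x, Ω x v u = 0) →
        v ∈ tangentSubspace 𝓘(ℝ, E) N x := by
  obtain ⟨n, hn, hsub⟩ := hN.isSubmanifold
  have : FiniteDimensional ℝ (TangentSpace 𝓘(ℝ, E) x) :=
    inferInstanceAs (FiniteDimensional ℝ E)
  let b : LinearMap.BilinForm ℝ (TangentSpace 𝓘(ℝ, E) x) :=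
    (ContinuousLinearMap.coeLM ℝ).comp (Ω x).toLinearMap
  -- Slice charts supply only the lower bound n for the dimension of the tangent space; isotropy
  -- forces equality.
  have h := lagrangian_of_isotropic (b := b) (fun v => hΩ.alternating x v)
    (fun v hv => hΩ.nondegenerate x v hv) hn (hsub.le_finrank_tangentSubspace hx)
    (fun u hu v hv => hN.isotropic x hx u hu v hv)
  exact ⟨by rw [h.1, hn], h.2⟩

variable [MulAction ℝˣ M] [ContMDiffSMul 𝓘(ℝ, ℝ) 𝓘(ℝ, E) ∞ ℝˣ M]

/-- The differential of `h_z` maps the tangent space of a homogeneous Lagrangian submanifold onto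
its tangent space at the image point. -/
theorem dActionTangent_surjective (hΩ : IsSymplectic Ω) (hh : IsHomogeneousBilin 1 Ω)
    (hN : IsLagrangian Ω N) (hNh : IsHomogeneousSet N) (z : ℝˣ) (x : N) :
    Function.Surjective (dActionTangent (E := E) hNh z x) := by
  have h1 := (hN.tangentSubspace_maximal hΩ x.2).1
  have h2 := (hN.tangentSubspace_maximal hΩ (hNh.act z x).2).1
  have f1 : FiniteDimensional ℝ (TangentSpace 𝓘(ℝ, E) (x : M)) :=
    inferInstanceAs (FiniteDimensional ℝ E)
  have f2 : FiniteDimensional ℝ (TangentSpace 𝓘(ℝ, E) (hNh.act z x : M)) :=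
    inferInstanceAs (FiniteDimensional ℝ E)
  -- Both tangent spaces have half the dimension of `E`, so injectivity suffices.
  refine (LinearMap.injective_iff_surjective_of_finrank_eq_finrank (by omega)).1 fun u v huv => ?_
  exact Subtype.ext (dAction_injective hΩ hh z x (congrArg Subtype.val huv))

/-- A section of the normal bundle is `0`-homogeneous if and only if the corresponding 1-form is
`1`-homogeneous. -/
theorem NormalField.isHomogeneous_zero_iff (hΩ : IsSymplectic Ω) (hh : IsHomogeneousBilin 1 Ω)
    (hN : IsLagrangian Ω N) (hNh : IsHomogeneousSet N) (ν : NormalField E N) :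
    ν.IsHomogeneous hNh 0 ↔ (ν.toOneForm Ω hN.isotropic).IsHomogeneous hNh 1 := by
  refine forall₂_congr fun z x => ?_
  obtain ⟨v, hv⟩ := Submodule.Quotient.mk_surjective _ (ν x)
  obtain ⟨v', hv'⟩ := Submodule.Quotient.mk_surjective _ (ν (hNh.act z x))
  obtain ⟨a, ha⟩ : ∃ a : TangentSpace 𝓘(ℝ, E) (hNh.act z x : M), a = dAction E z (x : M) v :=
    ⟨_, rfl⟩
  have hsub : ∀ u : tangentSubspace 𝓘(ℝ, E) N (x : M),
      Ω (hNh.act z x : M) (a - v') (dActionTangent hNh z x u)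
        = (z : ℝ) * Ω x v u - Ω (hNh.act z x : M) v' (dActionTangent hNh z x u) := fun u => by
    have h := hh z x v u
    rw [zpow_one] at h
    rw [map_sub, ← h, ha]
    rfl
  have hleft : dActionNormal hNh z x (ν x) = (z : ℝ) ^ (0 : ℤ) • ν (hNh.act z x)
      ↔ a - v' ∈ tangentSubspace 𝓘(ℝ, E) N (hNh.act z x : M) := by
    rw [zpow_zero, one_smul, ← hv, ← hv', ha]
    exact Submodule.Quotient.eq _
  have hright : ∀ u : tangentSubspace 𝓘(ℝ, E) N (x : M),
      ν.toOneForm Ω hN.isotropic (hNh.act z x) (dActionTangent hNh z x u)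
        = (z : ℝ) ^ (1 : ℤ) * ν.toOneForm Ω hN.isotropic x u
      ↔ Ω (hNh.act z x : M) (a - v') (dActionTangent hNh z x u) = 0 := fun u => by
    rw [ν.toOneForm_apply Ω hN.isotropic x v hv.symm,
      ν.toOneForm_apply Ω hN.isotropic _ v' hv'.symm, hsub u, zpow_one, sub_eq_zero]
    exact eq_comm
  rw [hleft]
  refine Iff.trans ?_ (forall_congr' hright).symm
  constructor
  · intro h u
    exact hN.isotropic _ (hNh.act z x).2 _ h _ (dActionTangent hNh z x u).2
  · intro h
    -- Orthogonality is known only for vectors in the image of dh_z; surjectivity extends it to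
    -- every tangent vector, and maximality then gives tangency.
    refine (hN.tangentSubspace_maximal hΩ (hNh.act z x).2).2 _ fun u hu => ?_
    obtain ⟨u', hu'⟩ := dActionTangent_surjective hΩ hh hN hNh z x ⟨u, hu⟩
    have := h u'
    rwa [hu'] at this

end Lagrangian

/-! ### The normal variation: well-definedness, smoothness, homogeneity. -/

section Variation

variable {E : Type*} [NormedAddCommGroup E] [NormedSpace ℝ E]
  {M : Type*} [TopologicalSpace M] [ChartedSpace E M]
  {J : Set ℝ} {L : ℝ → Set M} {s : ℝ}

/-- The action of `z` sends `L`-paths to `L`-paths. -/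
theorem dAction_mem_pathVelocities [MulAction ℝˣ M]
    [ContMDiffSMul 𝓘(ℝ, ℝ) 𝓘(ℝ, E) ∞ ℝˣ M] (hL : ∀ t ∈ J, IsHomogeneousSet (L t))
    (hJ : UniqueDiffWithinAt ℝ J s) (hs : s ∈ J) (z : ℝˣ) {x : M}
    {v : TangentSpace 𝓘(ℝ, E) x} (hv : v ∈ pathVelocities E J L s x) :
    dAction E z x v ∈ pathVelocities E J L s (z • x) := by
  obtain ⟨γ, ε, hε, hγ, hγL, rfl, hv⟩ := hv
  have hz : ContMDiff 𝓘(ℝ, E) 𝓘(ℝ, E) ∞ (fun y : M => z • y) :=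
    (ContMDiffSMul.contMDiff_smul (I := 𝓘(ℝ, ℝ)) (I' := 𝓘(ℝ, E)) (n := ∞) (G := ℝˣ) (M := M)).comp
      (contMDiff_const.prodMk contMDiff_id)
  refine ⟨fun t => z • γ t, ε, hε, hz.comp_contMDiffOn hγ,
    fun t ht => hL t ht.1 z _ (hγL t ht), rfl, ?_⟩
  have hnhds : Ioo (s - ε) (s + ε) ∈ 𝓝 s := Ioo_mem_nhds (by linarith) (by linarith)
  have hγd : MDifferentiableWithinAt 𝓘(ℝ, ℝ) 𝓘(ℝ, E) γ J s :=
    (mdifferentiableWithinAt_inter hnhds).1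
      ((hγ _ ⟨hs, mem_of_mem_nhds hnhds⟩).mdifferentiableWithinAt (by simp))
  have h := (hz.mdifferentiable (by simp) (γ s)).hasMFDerivAt.comp_hasMFDerivWithinAt s
    hγd.hasMFDerivWithinAt
  have h1 := congrArg (fun A : ℝ →L[ℝ] E => A (1 : ℝ)) (h.mfderivWithin hJ.uniqueMDiffWithinAt)
  have hv' : v = mfderivWithin 𝓘(ℝ, ℝ) 𝓘(ℝ, E) γ J s (1 : ℝ) := hv
  rw [hv']
  exact h1.symm

/-- The 1-form on an isotropic submanifold defined by a smooth section of the normal bundle is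
smooth. -/
theorem NormalField.IsSmooth.toOneForm [IsManifold 𝓘(ℝ, E) ∞ M] {N : Set M} {ν : NormalField E N} (hν : ν.IsSmooth)
    {Ω : BilinField E M} (hΩ : IsSymplectic Ω) (hN : IsIsotropic Ω N) :
    (ν.toOneForm Ω hN).IsSmooth := by
  intro x
  obtain ⟨U, hU, hxU, V, hV, hνV⟩ := hν x
  refine ⟨U, hU, hxU, fun y => Ω y (V y), ?_, fun y hy u =>
    ν.toOneForm_apply Ω hN y (V y) (hνV y hy) u⟩
  exact ContMDiffOn.clm_bundle_apply (b := id) (hΩ.smooth.contMDiffOn) hV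

variable [FiniteDimensional ℝ E]

/-- The velocity picked by choice in `normalVariation` differs from `v` by a tangent vector, so any
`L`-path may be used to compute the class. -/
theorem normalVariation_eq_mk (hL : IsSubmersiveSubmanifold E J L)
    (hJ : UniqueDiffWithinAt ℝ J s) (hs : s ∈ J) (x : L s) {v : TangentSpace 𝓘(ℝ, E) (x : M)}
    (hv : v ∈ pathVelocities E J L s (x : M)) :
    normalVariation E J L s x = Submodule.Quotient.mk v := by
  have hne : (pathVelocities E J L s (x : M)).Nonempty := ⟨v, hv⟩
  obtain ⟨S⟩ := hL.nonempty_slice (p := ((x : M), s)) ⟨hs, x.2⟩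
  unfold normalVariation
  rw [dif_pos hne]
  exact (Submodule.Quotient.eq _).2 (S.sub_mem_tangentSubspace hJ hs hne.some_mem hv)

variable [IsManifold 𝓘(ℝ, E) ∞ M]

/-- Locally the velocities of `L`-paths can be chosen as the values of a smooth vector field. -/
theorem exists_velocity_field (hL : IsSubmersiveSubmanifold E J L)
    (hJ : UniqueDiffWithinAt ℝ J s) (hs : s ∈ J) (x : L s) :
    ∃ U : Set M, IsOpen U ∧ (x : M) ∈ U ∧ ∃ V : (y : M) → TangentSpace 𝓘(ℝ, E) y,
      ContMDiffOn 𝓘(ℝ, E) 𝓘(ℝ, E).tangent ∞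
        (fun y => (⟨y, V y⟩ : TangentBundle 𝓘(ℝ, E) M)) U ∧
      ∀ y ∈ U, y ∈ L s → V y ∈ pathVelocities E J L s y := by
  obtain ⟨S⟩ := hL.nonempty_slice (p := ((x : M), s)) ⟨hs, x.2⟩
  exact ⟨S.domain s, S.isOpen_domain s, S.mem_domain, S.velocityField s,
    S.contMDiffOn_velocityField s,
    fun y hy hyL => S.velocityField_mem_pathVelocities hJ hs hy hyL⟩

theorem normalVariation_isSmooth (hL : IsSubmersiveSubmanifold E J L)
    (hJ : UniqueDiffWithinAt ℝ J s) (hs : s ∈ J) : (normalVariation E J L s).IsSmooth := by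
  intro x
  obtain ⟨U, hU, hxU, V, hV, hVL⟩ := exists_velocity_field hL hJ hs x
  exact ⟨U, hU, hxU, V, hV, fun y hy => normalVariation_eq_mk hL hJ hs y (hVL y hy y.2)⟩

variable [MulAction ℝˣ M] [ContMDiffSMul 𝓘(ℝ, ℝ) 𝓘(ℝ, E) ∞ ℝˣ M]

/-- If `v` represents the class at `x`, its image under dh_z is the velocity of the transported
`L`-path and so represents the class at z • x. -/
theorem normalVariation_isHomogeneous (hL : IsSubmersiveSubmanifold E J L)
    (hLh : ∀ t ∈ J, IsHomogeneousSet (L t)) (hJ : UniqueDiffWithinAt ℝ J s) (hs : s ∈ J) :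
    (normalVariation E J L s).IsHomogeneous (hLh s hs) 0 := by
  intro z x
  obtain ⟨U, -, hxU, V, -, hVL⟩ := exists_velocity_field hL hJ hs x
  have hv := hVL x hxU x.2
  rw [zpow_zero, one_smul, normalVariation_eq_mk hL hJ hs x hv,
    normalVariation_eq_mk hL hJ hs ((hLh s hs).act z x)
      (dAction_mem_pathVelocities hLh hJ hs z hv)]
  rfl

end Variation
end HomLag
end
open HomLag in
theorem mainTheorem7
    {E : Type*} [NormedAddCommGroup E] [NormedSpace ℝ E] [FiniteDimensional ℝ E]
    {M : Type*} [TopologicalSpace M] [ChartedSpace E M] [IsManifold 𝓘(ℝ, E) ∞ M]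
    [T2Space M] [SecondCountableTopology M]
    {EB : Type*} [NormedAddCommGroup EB] [NormedSpace ℝ EB] [FiniteDimensional ℝ EB]
    {B : Type*} [TopologicalSpace B] [ChartedSpace EB B] [IsManifold 𝓘(ℝ, EB) ∞ B]
    [T2Space B] [SecondCountableTopology B]
    [MulAction ℝˣ M] [ContMDiffSMul 𝓘(ℝ, ℝ) 𝓘(ℝ, E) ∞ ℝˣ M]
    (τ : M → B) (Ω : BilinField E M) (hΩ : IsHomogeneousSymplectic (EB := EB) τ Ω)
    (J : Set ℝ) (hJ : J.OrdConnected) (hJ' : (interior J).Nonempty)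
    (L : ℝ → Set M) (hL : IsSmoothFamily Ω J L)
    (s : ℝ) (hs : s ∈ J) :
    -- the normal variation and the variation form are well defined and smooth
    (∀ x : L s, (pathVelocities E J L s (x : M)).Nonempty ∧
      ∀ v ∈ pathVelocities E J L s (x : M),
        normalVariation E J L s x = Submodule.Quotient.mk v) ∧
    (normalVariation E J L s).IsSmooth ∧
    (variationForm Ω J L s (hL.lagrangian s hs).isotropic).IsSmooth ∧
    -- the normal variation is 0-homogeneous and the variation form is 1-homogeneous
    (normalVariation E J L s).IsHomogeneous (hL.homogeneous s hs) 0 ∧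
    (variationForm Ω J L s (hL.lagrangian s hs).isotropic).IsHomogeneous
      (hL.homogeneous s hs) 1 ∧
    -- the two homogeneity conditions are equivalent, for every section of the normal bundle
    (∀ ν : NormalField E (L s), ν.IsHomogeneous (hL.homogeneous s hs) 0 ↔
      (ν.toOneForm Ω (hL.lagrangian s hs).isotropic).IsHomogeneous (hL.homogeneous s hs) 1) := by

  -- A nondegenerate interval determines derivatives within it at all its points, endpoints
  -- included, so velocities of `L`-paths are meaningful there.
  have hJs : UniqueDiffWithinAt ℝ J s := uniqueDiffOn_convex hJ.convex hJ' s hs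
  have hsub := hL.submersive
  have hlag := hL.lagrangian s hs
  have hsmooth := normalVariation_isSmooth hsub hJs hs
  have hhom := normalVariation_isHomogeneous hsub hL.homogeneous hJs hs
  have hiff := NormalField.isHomogeneous_zero_iff hΩ.symplectic hΩ.homogeneous hlag
    (hL.homogeneous s hs)
  refine ⟨fun x => ⟨?_, fun v hv => normalVariation_eq_mk hsub hJs hs x hv⟩, hsmooth,
    hsmooth.toOneForm hΩ.symplectic hlag.isotropic, hhom, (hiff _).1 hhom, hiff⟩
  obtain ⟨U, -, hxU, V, -, hVL⟩ := exists_velocity_field hsub hJs hs x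
  exact ⟨V x, hVL x hxU x.2⟩
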